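/- Let $\mathcal H$ be a complex Hilbert space. A bounded operator $T$ on $\mathcal H$ is positive, $T\ge 0$, if $(Tx,x)\ge 0$ for all $x$, and strictly positive, $T>0$, if it is positive and invertible; $S\ge T$ means $S-T\ge 0$. Let $n\ge 1$, let $A_1,\dots,A_{2n}$ be strictly positive operators on $\mathcal H$, and let $m\ge 2$ be an integer. Call real parameters $t_1,\dots,t_n\in[0,1]$, $p_1,\dots,p_{2n}\ge 1$ and $r\ge t_n$ admissible if $$(r-t_n)\,m=\psi[2n]-t_n+r,\qquad\text{where } \psi[0]=1,\quad \psi[2k]=(\psi[2k-2]\,p_{2k-1}-t_k)\,p_{2k}+t_k ,$$ that is, $\psi[2n]=\{\cdots[\{[(p_1-t_1)p_2+t_1]p_3-t_2\}p_4+t_2]p_5-\cdots-t_n\}p_{2n}+t_n$. For strictly positive $B_1,\dots,B_{2n}$ put $$N_1=\big(B_2^{-t_1/2}B_1^{p_1}B_2^{-t_1/2}\big)^{p_2},\qquad N_{k}=\Big[B_{2k}^{-t_k/2}\big\{B_{2k-1}^{t_{k-1}/2}\,N_{k-1}\,B_{2k-1}^{t_{k-1}/2}\big\}^{p_{2k-1}}B_{2k}^{-t_k/2}\Big]^{p_{2k}}\quad(2\le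 k\le n),$$ and $N(B_1,\dots,B_{2n})=N_n$. For $1\le i\le n$ let $Y_i=N(A_i,A_{i+1},\dots,A_{2n-1},A_{2n},A_{2n},\dots,A_{2n})$, the $j$-th entry being $A_{\min(i+j-1,2n)}$; for $n+1\le i\le 2n-1$ let $Y_i=N(A_{i+1},A_i,\dots,A_2,A_1,A_1,\dots,A_1)$, the $j$-th entry being $A_{\max(i+2-j,1)}$. For given admissible parameters consider, for each $i=1,\dots,2n-1$, the inequality $$(\mathrm{II}.i)\qquad \begin{cases} A_{2n}^{r-t_n}\ \ge\ \big\{A_{2n}^{r/2}\,Y_i\,A_{2n}^{r/2}\big\}^{1/m}, & 1\le i\le n,\\[2pt] A_{1}^{r-t_n}\ \le\ \big\{A_{1}^{r/2}\,Y_i\,A_{1}^{r/2}\big\}^{1/m}, & n+1\le i\le 2n-1,\end{cases}$$ and, for an unknown strictly positive operator $S_i$, the equalities $$(\mathrm{III}.i)\qquad C^{-t_n/2}\,T\,(C^{r-t_n}T)^{m-1}C^{-t_n/2}=C^{-t_n/2}(T\,C^{r-t_n})^{m-1}T\,C^{-t_n/2}=Y_i ,$$ where $C=A_{2n}$, $T=S_i$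 if $1\le i\le n$, and $C=A_1$, $T=S_i^{-1}$ if $n+1\le i\le 2n-1$. Then the following assertions are mutually equivalent: (I) $A_{2n}\ge A_{2n-1}\ge\cdots\ge A_2\ge A_1$. (II) For all admissible parameters, the inequalities (II.$i$), $i=1,\dots,2n-1$, hold. (III) For all admissible parameters, there exist strictly positive operators $S_1,\dots,S_{2n-1}$ satisfying (III.$i$), $i=1,\dots,2n-1$, respectively, where each $S_i$ is the unique strictly positive solution of (III.$i$) and $\|S_i\|\le 1$. Moreover, for each choice of admissible parameters and each $i$, the inequality (II.$i$) holds if and only if (III.$i$) has a unique strictly positive solution $S_i$ and this solution satisfies $\|S_i\|\le 1$. -/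

import Mathlib

noncomputable section

namespace OperatorOrder

variable {H : Type*} [NormedAddCommGroup H] [InnerProductSpace ℂ H] [CompleteSpace H]

/-- The number `ψ[2k] = {⋯[{[(p₁ - t₁)p₂ + t₁]p₃ - t₂}p₄ + t₂]p₅ - ⋯ - t_k}p_{2k} + t_k`,
with `ψ[0] = 1`. The sequences `t₁, t₂, …` and `p₁, p₂, …` are indexed from `1`. -/
def psi (t p : ℕ → ℝ) : ℕ → ℝ
  | 0 => 1
  | k + 1 => (psi t p k * p (2 * k + 1) - t (k + 1)) * p (2 * k + 2) + t (k + 1)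

/-- The nested expression in `B₁, …, B_{2n}` (indexed from `1`)
`[B_{2n}^{-t_n/2} {B_{2n-1}^{t_{n-1}/2} ⋯ {B₃^{t₁/2} (B₂^{-t₁/2} B₁^{p₁} B₂^{-t₁/2})^{p₂}
B₃^{t₁/2}}^{p₃} ⋯ B_{2n-1}^{t_{n-1}/2}}^{p_{2n-1}} B_{2n}^{-t_n/2}]^{p_{2n}}`.
Real powers are those of the continuous functional calculus; the value at `n = 0` is not used. -/
def nest (B : ℕ → H →L[ℂ] H) (t p : ℕ → ℝ) : ℕ → (H →L[ℂ] H)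
  | 0 => 1
  | 1 => (B 2 ^ (-(t 1 / 2)) * B 1 ^ p 1 * B 2 ^ (-(t 1 / 2))) ^ p 2
  | k + 2 =>
      (B (2 * k + 4) ^ (-(t (k + 2) / 2)) *
        (B (2 * k + 3) ^ (t (k + 1) / 2) * nest B t p (k + 1) * B (2 * k + 3) ^ (t (k + 1) / 2))
          ^ p (2 * k + 3) *
        B (2 * k + 4) ^ (-(t (k + 2) / 2))) ^ p (2 * k + 4)

/-- The increasing sequence `A_i, A_{i+1}, …, A_{2n-1}, A_{2n}, A_{2n}, A_{2n}, …`,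
indexed from `1`. -/
def up (n : ℕ) (A : ℕ → H →L[ℂ] H) (i : ℕ) : ℕ → H →L[ℂ] H :=
  fun j => A (min (i + j - 1) (2 * n))

/-- The decreasing sequence `A_{i+1}, A_i, …, A_2, A_1, A_1, A_1, …`, indexed from `1`. -/
def down (A : ℕ → H →L[ℂ] H) (i : ℕ) : ℕ → H →L[ℂ] H :=
  fun j => A (max (i + 2 - j) 1)

/-- The order chain `A_{2n} ≥ A_{2n-1} ≥ ⋯ ≥ A_2 ≥ A_1`. -/
def OrderChain (n : ℕ) (A : ℕ → H →L[ℂ] H) : Prop :=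
  ∀ i, 1 ≤ i → i < 2 * n → A i ≤ A (i + 1)

/-- The conditions on the parameters `t₁, …, t_n`, `p₁, …, p_{2n}` and `r` for a given `m`. -/
structure Admissible (n m : ℕ) (t p : ℕ → ℝ) (r : ℝ) : Prop where
  t_mem : ∀ i, 1 ≤ i → i ≤ n → t i ∈ Set.Icc (0 : ℝ) 1
  one_le_p : ∀ j, 1 ≤ j → j ≤ 2 * n → 1 ≤ p j
  t_le_r : t n ≤ r
  r_eq : (r - t n) * (m : ℝ) = psi t p n - t n + r

/-- The `i`-th operator inequality, `1 ≤ i ≤ 2n - 1`: for `i ≤ n` it bounds a power of `A_{2n}`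
from below, for `i > n` it bounds a power of `A_1` from above. -/
def Inequality (n m : ℕ) (A : ℕ → H →L[ℂ] H) (t p : ℕ → ℝ) (r : ℝ) (i : ℕ) : Prop :=
  if i ≤ n then
    (A (2 * n) ^ (r / 2) * nest (up n A i) t p n * A (2 * n) ^ (r / 2)) ^ (1 / (m : ℝ))
      ≤ A (2 * n) ^ (r - t n)
  else
    A 1 ^ (r - t n)
      ≤ (A 1 ^ (r / 2) * nest (down A i) t p n * A 1 ^ (r / 2)) ^ (1 / (m : ℝ))

/-- The pair of operator equalities
`C^{-u/2} T (C^{r-u} T)^{m-1} C^{-u/2} = C^{-u/2} (T C^{r-u})^{m-1} T C^{-u/2} = Y`. -/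
def FactorEq (m : ℕ) (C : H →L[ℂ] H) (u r : ℝ) (T Y : H →L[ℂ] H) : Prop :=
  C ^ (-(u / 2)) * T * (C ^ (r - u) * T) ^ (m - 1) * C ^ (-(u / 2)) =
      C ^ (-(u / 2)) * (T * C ^ (r - u)) ^ (m - 1) * T * C ^ (-(u / 2)) ∧
    C ^ (-(u / 2)) * (T * C ^ (r - u)) ^ (m - 1) * T * C ^ (-(u / 2)) = Y

/-- The `i`-th operator equality for the unknown `S`, `1 ≤ i ≤ 2n - 1`: it involves `A_{2n}` and
`S` for `i ≤ n`, and `A_1` and `S⁻¹` for `i > n`. -/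
def Equality (n m : ℕ) (A : ℕ → H →L[ℂ] H) (t p : ℕ → ℝ) (r : ℝ) (i : ℕ)
    (S : H →L[ℂ] H) : Prop :=
  if i ≤ n then
    FactorEq m (A (2 * n)) (t n) r S (nest (up n A i) t p n)
  else
    FactorEq m (A 1) (t n) r (Ring.inverse S) (nest (down A i) t p n)

/-- Among the strictly positive operators there is exactly one solution `S` of the `i`-th operator
equality, and it is a contraction. -/
def HasUniqueContraction (n m : ℕ) (A : ℕ → H →L[ℂ] H) (t p : ℕ → ℝ) (r : ℝ) (i : ℕ) : Prop :=
  ∃ S : H →L[ℂ] H, IsStrictlyPositive S ∧ Equality n m A t p r i S ∧ ‖S‖ ≤ 1 ∧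
    ∀ S' : H →L[ℂ] H, IsStrictlyPositive S' → Equality n m A t p r i S' → S' = S

end OperatorOrder

end

set_option linter.unusedSectionVars false

namespace OperatorOrder

/-! ### Real powers and congruences in a C*-algebra. -/

section CStar

variable {𝒜 : Type*} [CStarAlgebra 𝒜] [PartialOrder 𝒜] [StarOrderedRing 𝒜]

/-! (I) → (II): along an increasing sequence the nested expression collapses to `B_{2k}^{-t_k/2}
e^{ψ[2k]} B_{2k}^{-t_k/2}` with some `0 < e ≤ B_{2k}` (`exists_nest_eq`). Furuta's inequality for `e
≤ B_{2n}` then gives the bound, and admissibility says exactly that its exponent is `1/m`. Inverting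
all operators reverses the order and commutes with the nesting (`nest_rpow_neg_one`), which settles
decreasing sequences.

(II) → (I): put every `t_i` and `p_j` except `p₂ = N` equal to `1`. Then `ψ = 1` whatever `N` is,
and the nested expression is a fixed congruence of `x^N` with `x = B₂^{-1/2} B₁ B₂^{-1/2}`. A bound
uniform in `N` forces `x ≤ 1`, that is `B₁ ≤ B₂` (`le_one_of_conj_pow_rpow_le`), and each index `i`
yields one link of the chain.

(II.i) ↔ (III.i): after congruence by `C^{r/2}` the equality says that `C^{(r-u)/2} T C^{(r-u)/2}`,
with `u = t_n`, is an `m`-th root of `C^{r/2} Y C^{r/2}`. Uniqueness of positive roots determines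
`T` (`factorEq_iff`), and the norm condition becomes the inequality. -/

lemma rpow_rpow_of_isStrictlyPositive {a : 𝒜} (ha : IsStrictlyPositive a) (x y : ℝ) :
    (a ^ x) ^ y = a ^ (x * y) := by
  rcases eq_or_ne x 0 with rfl | hx
  · rw [zero_mul, CFC.rpow_zero a ha.nonneg, CFC.one_rpow]
  · exact CFC.rpow_rpow a x y hx ha

lemma star_rpow (a : 𝒜) (x : ℝ) : star (a ^ x) = a ^ x :=
  (IsSelfAdjoint.of_nonneg CFC.rpow_nonneg).star_eq

lemma rpow_mul_rpow {a : 𝒜} (ha : IsStrictlyPositive a) (x y : ℝ) :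
    a ^ x * a ^ y = a ^ (x + y) :=
  (CFC.rpow_add ha.isUnit).symm

lemma isStrictlyPositive_rpow {a : 𝒜} (ha : IsStrictlyPositive a) (x : ℝ) :
    IsStrictlyPositive (a ^ x) := ha.rpow a x

lemma isStrictlyPositive_rpow_conj {a b : 𝒜} (ha : IsStrictlyPositive a)
    (hb : IsStrictlyPositive b) (x : ℝ) : IsStrictlyPositive (a ^ x * b * a ^ x) := by
  have := ((isStrictlyPositive_rpow ha x).isUnit.isStrictlyPositive_star_right_conjugate_iff
    (a := b)).2 hb
  rwa [star_rpow] at this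

lemma rpow_conj_le_rpow_conj {b c : 𝒜} (h : b ≤ c) (a : 𝒜) (x : ℝ) :
    a ^ x * b * a ^ x ≤ a ^ x * c * a ^ x :=
  conjugate_le_conjugate_of_nonneg h CFC.rpow_nonneg

/-- Inner conjugation by powers of one element merges. -/
lemma rpow_conj_rpow_conj {a : 𝒜} (ha : IsStrictlyPositive a) (x y : ℝ) (b : 𝒜) :
    a ^ x * (a ^ y * b * a ^ y) * a ^ x = a ^ (x + y) * b * a ^ (x + y) := by
  calc _ = a ^ x * a ^ y * b * (a ^ y * a ^ x) := by simp only [mul_assoc]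
    _ = _ := by rw [rpow_mul_rpow ha, rpow_mul_rpow ha, add_comm y x]

lemma rpow_conj_rpow {a : 𝒜} (ha : IsStrictlyPositive a) (x y : ℝ) :
    a ^ x * a ^ y * a ^ x = a ^ (x + y + x) := by
  rw [rpow_mul_rpow ha, rpow_mul_rpow ha]

lemma rpow_conj_rpow_conj_cancel {a : 𝒜} (ha : IsStrictlyPositive a) {x y : ℝ} (h : x + y = 0)
    (b : 𝒜) : a ^ x * (a ^ y * b * a ^ y) * a ^ x = b := by
  rw [rpow_conj_rpow_conj ha, h, CFC.rpow_zero a ha.nonneg, one_mul, mul_one]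

lemma rpow_conj_neg_one {a b : 𝒜} (ha : IsStrictlyPositive a) (hb : IsStrictlyPositive b)
    (x : ℝ) : (a ^ x * b * a ^ x) ^ (-1 : ℝ) = a ^ (-x) * b ^ (-1 : ℝ) * a ^ (-x) := by
  rw [← CFC.inverse_eq_rpow_neg_one (isStrictlyPositive_rpow_conj ha hb x)]
  have hu := (isStrictlyPositive_rpow_conj ha hb x).isUnit
  refine hu.mul_right_cancel ?_
  rw [Ring.inverse_mul_cancel _ hu]
  have h1 : b ^ (-1 : ℝ) * b = 1 := by
    simpa [CFC.rpow_one b hb.nonneg] using CFC.rpow_neg_mul_rpow 1 hb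
  have h2 := CFC.rpow_neg_mul_rpow x ha
  calc (1 : 𝒜) = a ^ (-x) * (b ^ (-1 : ℝ) * b) * a ^ x := by rw [h1, mul_one, h2]
    _ = a ^ (-x) * (b ^ (-1 : ℝ) * ((a ^ (-x) * a ^ x) * b)) * a ^ x := by rw [h2, one_mul]
    _ = a ^ (-x) * b ^ (-1 : ℝ) * a ^ (-x) * (a ^ x * b * a ^ x) := by simp only [mul_assoc]

lemma rpow_le_rpow_of_nonpos {a b : 𝒜} (ha : IsStrictlyPositive a) (hab : a ≤ b) {x : ℝ}
    (h0 : -1 ≤ x) (h1 : x ≤ 0) : b ^ x ≤ a ^ x := by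
  have h := CStarAlgebra.rpow_neg_one_le_rpow_neg_one
    (CFC.rpow_le_rpow (p := -x) ⟨by linarith, by linarith⟩ hab) (isStrictlyPositive_rpow ha _)
  rwa [rpow_rpow_of_isStrictlyPositive ha, rpow_rpow_of_isStrictlyPositive (ha.of_le hab),
    mul_neg_one, neg_neg] at h

lemma unitary_conj_rpow (u : unitary 𝒜) {a : 𝒜} (ha : IsStrictlyPositive a) (x : ℝ) :
    ((u : 𝒜) * a * star (u : 𝒜)) ^ x = u * a ^ x * star (u : 𝒜) := by
  have h0 : (0 : NNReal) ∉ spectrum NNReal a := spectrum.zero_notMem _ ha.isUnit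
  have hφ : Continuous (Unitary.conjStarAlgAut ℂ 𝒜 u) := by
    change Continuous fun b : 𝒜 => (u : 𝒜) * b * star (u : 𝒜)
    fun_prop
  have h := StarAlgHomClass.map_cfc (S := ℂ) (Unitary.conjStarAlgAut ℂ 𝒜 u)
    (fun z : NNReal => z ^ x) a
    (fun z hz => (NNReal.continuousAt_rpow_const
      (.inl (ne_of_mem_of_not_mem hz h0))).continuousWithinAt) hφ ha.nonneg
    (star_right_conjugate_nonneg ha.nonneg (u : 𝒜))
  exact h.symm

/-- Polar decomposition: `y = u |y|` with `u` unitary, so `y y* = u (y* y) u*`, and powers commute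
with unitary conjugation. -/
lemma mul_star_rpow {y : 𝒜} (hy : IsUnit y) (x : ℝ) :
    (y * star y) ^ x = y * (star y * y) ^ (x - 1) * star y := by
  have hh : IsStrictlyPositive (star y * y) := by
    simpa using (hy.isStrictlyPositive_star_left_conjugate_iff (a := (1 : 𝒜))).2 (by simp)
  set h := star y * y with hdef
  have hu1 : star (y * h ^ (-(1 / 2) : ℝ)) * (y * h ^ (-(1 / 2) : ℝ)) = 1 := by
    rw [star_mul, star_rpow, mul_assoc, ← mul_assoc (star y), ← hdef, ← mul_assoc]
    exact CFC.conjugate_rpow_neg_one_half h hh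
  have hu2 : (y * h ^ (-(1 / 2) : ℝ)) * star (y * h ^ (-(1 / 2) : ℝ)) = 1 := by
    have hU : IsUnit (y * h ^ (-(1 / 2) : ℝ)) := hy.mul (isStrictlyPositive_rpow hh _).isUnit
    obtain ⟨v, hv⟩ := hU
    rw [← hv] at hu1 ⊢
    rw [Units.mul_eq_one_iff_eq_inv.1 hu1, Units.mul_inv]
  have key := unitary_conj_rpow ⟨y * h ^ (-(1 / 2) : ℝ), hu1, hu2⟩ hh x
  have conj (c : 𝒜) : y * h ^ (-(1 / 2) : ℝ) * c * star (y * h ^ (-(1 / 2) : ℝ)) =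
      y * (h ^ (-(1 / 2) : ℝ) * c * h ^ (-(1 / 2) : ℝ)) * star y := by
    rw [star_mul, star_rpow]
    simp only [mul_assoc]
  rw [conj, conj, CFC.conjugate_rpow_neg_one_half h hh, mul_one, rpow_conj_rpow hh] at key
  rw [key]
  congr 3
  ring

/-! ### Furuta-type inequalities. -/

/-- Furuta's lemma on powers of `x b^p x*`. -/
lemma conj_rpow_rpow {b x : 𝒜} (hb : IsStrictlyPositive b) (hx : IsUnit x) (p l : ℝ) :
    (x * b ^ p * star x) ^ l =
      x * (b ^ (p / 2) * (b ^ (p / 2) * (star x * x) * b ^ (p / 2)) ^ (l - 1) * b ^ (p / 2))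
        * star x := by
  have h := mul_star_rpow (hx.mul (isStrictlyPositive_rpow hb (p / 2)).isUnit) l
  have e : b ^ p = b ^ (p / 2) * b ^ (p / 2) := by rw [rpow_mul_rpow hb, add_halves]
  rw [star_mul, star_rpow] at h
  simp only [e, mul_assoc] at h ⊢
  exact h

/-- In Furuta's lemma the inner exponent `l - 1` lies in `[-1, 0]`, where powers reverse order, so a
lower bound on `x* x` gives an upper bound. -/
lemma conj_rpow_rpow_le_of_rpow_le {b x : 𝒜} (hb : IsStrictlyPositive b) (hx : IsUnit x)
    {p e l : ℝ} (hbx : b ^ e ≤ star x * x) (hl0 : 0 ≤ l) (hl1 : l ≤ 1) :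
    (x * b ^ p * star x) ^ l ≤ x * b ^ (p + (p + e) * (l - 1)) * star x := by
  rw [conj_rpow_rpow hb hx]
  refine star_right_conjugate_le_conjugate ?_ x
  have h1 : b ^ (p + e) ≤ b ^ (p / 2) * (star x * x) * b ^ (p / 2) := by
    have := rpow_conj_le_rpow_conj hbx b (p / 2)
    rwa [rpow_conj_rpow hb, show p / 2 + e + p / 2 = p + e by ring] at this
  have h2 := rpow_le_rpow_of_nonpos (isStrictlyPositive_rpow hb _) h1 (x := l - 1)
    (by linarith) (by linarith)
  rw [rpow_rpow_of_isStrictlyPositive hb] at h2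
  have h3 := rpow_conj_le_rpow_conj h2 b (p / 2)
  rwa [rpow_conj_rpow hb, show p / 2 + (p + e) * (l - 1) + p / 2 = p + (p + e) * (l - 1) by ring]
    at h3

/-- Here `l - 1` lies in `[0, 1]`, and Löwner–Heinz preserves order. -/
lemma conj_rpow_rpow_le_of_le_rpow {b x : 𝒜} (hb : IsStrictlyPositive b) (hx : IsUnit x)
    {p e l : ℝ} (hbx : star x * x ≤ b ^ e) (hl0 : 1 ≤ l) (hl1 : l ≤ 2) :
    (x * b ^ p * star x) ^ l ≤ x * b ^ (p + (p + e) * (l - 1)) * star x := by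
  rw [conj_rpow_rpow hb hx]
  refine star_right_conjugate_le_conjugate ?_ x
  have h1 : b ^ (p / 2) * (star x * x) * b ^ (p / 2) ≤ b ^ (p + e) := by
    have := rpow_conj_le_rpow_conj hbx b (p / 2)
    rwa [rpow_conj_rpow hb, show p / 2 + e + p / 2 = p + e by ring] at this
  have h2 := CFC.rpow_le_rpow (p := l - 1) ⟨by linarith, by linarith⟩ h1
  rw [rpow_rpow_of_isStrictlyPositive hb] at h2
  have h3 := rpow_conj_le_rpow_conj h2 b (p / 2)
  rwa [rpow_conj_rpow hb, show p / 2 + (p + e) * (l - 1) + p / 2 = p + (p + e) * (l - 1) by ring]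
    at h3

/-- If `b ≤ a ≤ c`, inserting the expansion `c^{t/2} a^{-t/2}` around `b^p` still gives an
operator whose `p`-th root lies below `c`. -/
lemma conj_conj_rpow_inv_le {a b c : 𝒜} (hb : IsStrictlyPositive b) (hba : b ≤ a) (hac : a ≤ c)
    {t p : ℝ} (ht : t ∈ Set.Icc (0 : ℝ) 1) (hp : 1 ≤ p) :
    (c ^ (t / 2) * (a ^ (-(t / 2)) * b ^ p * a ^ (-(t / 2))) * c ^ (t / 2)) ^ p⁻¹ ≤ c := by
  have ha := hb.of_le hba
  have hc := ha.of_le hac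
  have hx : IsUnit (c ^ (t / 2) * a ^ (-(t / 2))) :=
    (isStrictlyPositive_rpow hc _).isUnit.mul (isStrictlyPositive_rpow ha _).isUnit
  have hstar : star (c ^ (t / 2) * a ^ (-(t / 2))) = a ^ (-(t / 2)) * c ^ (t / 2) := by
    rw [star_mul, star_rpow, star_rpow]
  have h1 : b ^ (0 : ℝ) ≤ star (c ^ (t / 2) * a ^ (-(t / 2))) * (c ^ (t / 2) * a ^ (-(t / 2))) := by
    have := rpow_conj_le_rpow_conj (CFC.rpow_le_rpow ht hac) a (-(t / 2))
    rw [rpow_conj_rpow ha, show -(t / 2) + t + -(t / 2) = 0 by ring,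
      CFC.rpow_zero a ha.nonneg] at this
    rw [CFC.rpow_zero b hb.nonneg, hstar]
    refine this.trans_eq ?_
    rw [show c ^ t = c ^ (t / 2) * c ^ (t / 2) by rw [rpow_mul_rpow hc, add_halves]]
    simp only [mul_assoc]
  -- With `e = 0` and `l = 1/p` the power of `b` left inside the congruence is exactly `1`.
  have h2 := conj_rpow_rpow_le_of_rpow_le (p := p) hb hx h1 (inv_nonneg.2 (by linarith))
    (inv_le_one_of_one_le₀ hp)
  rw [show p + (p + 0) * (p⁻¹ - 1) = 1 by field_simp; ring, CFC.rpow_one b hb.nonneg, hstar] at h2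
  have h3 : a ^ (-(t / 2)) * b * a ^ (-(t / 2)) ≤ c ^ (1 - t) := by
    have := rpow_conj_le_rpow_conj hba a (-(t / 2))
    nth_rw 4 [← CFC.rpow_one a ha.nonneg] at this
    rw [rpow_conj_rpow ha, show -(t / 2) + 1 + -(t / 2) = 1 - t by ring] at this
    exact this.trans (CFC.rpow_le_rpow ⟨by linarith [ht.2], by linarith [ht.1]⟩ hac)
  have h4 := rpow_conj_le_rpow_conj h3 c (t / 2)
  rw [rpow_conj_rpow hc, show t / 2 + (1 - t) + t / 2 = 1 by ring, CFC.rpow_one c hc.nonneg] at h4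
  simp only [mul_assoc] at h2 h4 ⊢
  exact h2.trans h4

/-- The equation determines `e`. Since `a^{-t} ≤ b^{-t}`, the estimate for exponents in `[1, 2]`
gives `e^{(p-t)s+t} ≤ b^{(p-t)s+t}`, and taking the root yields `e ≤ b ≤ a`. -/
lemma exists_rpow_conj_eq_of_le_two {a b : 𝒜} (hb : IsStrictlyPositive b) (hba : b ≤ a)
    {t p s : ℝ} (ht : t ∈ Set.Icc (0 : ℝ) 1) (hp : 1 ≤ p) (hs1 : 1 ≤ s) (hs2 : s ≤ 2) :
    ∃ e : 𝒜, IsStrictlyPositive e ∧ e ≤ a ∧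
      (a ^ (-(t / 2)) * b ^ p * a ^ (-(t / 2))) ^ s =
        a ^ (-(t / 2)) * e ^ ((p - t) * s + t) * a ^ (-(t / 2)) := by
  have ha := hb.of_le hba
  have hq : 1 ≤ (p - t) * s + t := by nlinarith [ht.1, ht.2]
  have hD := isStrictlyPositive_rpow
    (isStrictlyPositive_rpow_conj ha (isStrictlyPositive_rpow hb p) (-(t / 2))) s
  have hE := isStrictlyPositive_rpow_conj ha hD (t / 2)
  refine ⟨(a ^ (t / 2) * (a ^ (-(t / 2)) * b ^ p * a ^ (-(t / 2))) ^ s * a ^ (t / 2)) ^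
    ((p - t) * s + t)⁻¹, isStrictlyPositive_rpow hE _, ?_, ?_⟩
  · have hx : a ^ (-(t / 2)) * a ^ (-(t / 2)) ≤ b ^ (-t) := by
      rw [rpow_mul_rpow ha, show -(t / 2) + -(t / 2) = -t by ring]
      exact rpow_le_rpow_of_nonpos hb hba (by linarith [ht.2]) (by linarith [ht.1])
    have h1 := conj_rpow_rpow_le_of_le_rpow (p := p) (l := s) hb
      (isStrictlyPositive_rpow ha (-(t / 2))).isUnit (by rwa [star_rpow]) hs1 hs2
    rw [star_rpow] at h1
    have h2 := rpow_conj_le_rpow_conj h1 a (t / 2)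
    rw [rpow_conj_rpow_conj_cancel ha (by ring),
      show p + (p + -t) * (s - 1) = (p - t) * s + t by ring] at h2
    have h3 := CFC.rpow_le_rpow (p := ((p - t) * s + t)⁻¹)
      ⟨inv_nonneg.2 (by linarith), inv_le_one_of_one_le₀ hq⟩ h2
    rw [CFC.rpow_rpow_inv b _ (by linarith) hb] at h3
    exact h3.trans hba
  · rw [CFC.rpow_inv_rpow _ _ (by linarith) hE, rpow_conj_rpow_conj_cancel ha (by ring)]

/-- Large `s` is reached by repeated squaring: the conclusion has the form of the hypothesis, and `p
↦ (p - t)s + t` composes multiplicatively in `s`. -/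
lemma exists_rpow_conj_eq {a b : 𝒜} (hb : IsStrictlyPositive b) (hba : b ≤ a)
    {t p s : ℝ} (ht : t ∈ Set.Icc (0 : ℝ) 1) (hp : 1 ≤ p) (hs : 1 ≤ s) :
    ∃ e : 𝒜, IsStrictlyPositive e ∧ e ≤ a ∧
      (a ^ (-(t / 2)) * b ^ p * a ^ (-(t / 2))) ^ s =
        a ^ (-(t / 2)) * e ^ ((p - t) * s + t) * a ^ (-(t / 2)) := by
  have ha := hb.of_le hba
  obtain ⟨k, hk⟩ := pow_unbounded_of_one_lt s (one_lt_two : (1 : ℝ) < 2)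
  induction k generalizing s with
  | zero => exact exists_rpow_conj_eq_of_le_two hb hba ht hp hs (by norm_num at hk; linarith)
  | succ k ih =>
    rcases le_total s 2 with h2 | h2
    · exact exists_rpow_conj_eq_of_le_two hb hba ht hp hs h2
    obtain ⟨e, he, hea, heq⟩ := ih (s := s / 2) (by linarith) (by rw [pow_succ] at hk; linarith)
    have hq : 1 ≤ (p - t) * (s / 2) + t := by nlinarith [ht.1, ht.2]
    obtain ⟨f, hf, hfa, hfeq⟩ := exists_rpow_conj_eq_of_le_two he hea ht hq one_le_two le_rfl
    refine ⟨f, hf, hfa, ?_⟩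
    rw [← heq, rpow_rpow_of_isStrictlyPositive
      (isStrictlyPositive_rpow_conj ha (isStrictlyPositive_rpow hb p) _)] at hfeq
    convert hfeq using 2
    · ring
    · congr 2
      ring

lemma furuta_of_le_two {a b : 𝒜} (hb : IsStrictlyPositive b) (hba : b ≤ a)
    {q s : ℝ} (hq : 1 ≤ q) (hs1 : 1 ≤ s) (hs2 : s ≤ 2) :
    (a ^ ((s - 1) / 2) * b ^ q * a ^ ((s - 1) / 2)) ^ (s / (q + s - 1)) ≤ a ^ s := by
  have ha := hb.of_le hba
  have hx : b ^ (s - 1) ≤ a ^ ((s - 1) / 2) * a ^ ((s - 1) / 2) := by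
    rw [rpow_mul_rpow ha, add_halves]
    exact CFC.rpow_le_rpow ⟨by linarith, by linarith⟩ hba
  have h := conj_rpow_rpow_le_of_rpow_le (p := q) (l := s / (q + s - 1)) hb
    (isStrictlyPositive_rpow ha ((s - 1) / 2)).isUnit (by rwa [star_rpow])
    (div_nonneg (by linarith) (by linarith)) ((div_le_one (by linarith)).2 (by linarith))
  have hne : q + s - 1 ≠ 0 := by linarith
  rw [star_rpow, show q + (q + (s - 1)) * (s / (q + s - 1) - 1) = 1 by field_simp; ring,
    CFC.rpow_one b hb.nonneg] at h
  refine h.trans ?_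
  have h2 := rpow_conj_le_rpow_conj hba a ((s - 1) / 2)
  nth_rw 4 [← CFC.rpow_one a ha.nonneg] at h2
  rwa [rpow_conj_rpow ha, show (s - 1) / 2 + 1 + (s - 1) / 2 = s by ring] at h2

/-- Furuta's inequality, with `s = 1 + r`. -/
lemma furuta {a b : 𝒜} (hb : IsStrictlyPositive b) (hba : b ≤ a)
    {q s : ℝ} (hq : 1 ≤ q) (hs : 1 ≤ s) :
    (a ^ ((s - 1) / 2) * b ^ q * a ^ ((s - 1) / 2)) ^ (s / (q + s - 1)) ≤ a ^ s := by
  have ha := hb.of_le hba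
  obtain ⟨k, hk⟩ := pow_unbounded_of_one_lt s (one_lt_two : (1 : ℝ) < 2)
  induction k generalizing s with
  | zero => exact furuta_of_le_two hb hba hq hs (by norm_num at hk; linarith)
  | succ k ih =>
    rcases le_total s 2 with h2 | h2
    · exact furuta_of_le_two hb hba hq hs h2
    have h := ih (s := s / 2) (by linarith) (by rw [pow_succ] at hk; linarith)
    have hG := isStrictlyPositive_rpow_conj ha (isStrictlyPositive_rpow hb q) ((s / 2 - 1) / 2)
    have hq' : 1 ≤ (q + s / 2 - 1) / (s / 2) := (one_le_div (by linarith)).2 (by linarith)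
    -- The case `s = 2` is applied to the two sides of `h`; the exponent `(q + s/2 - 1)/(s/2)`
    -- undoes the power on the left.
    have h' := furuta_of_le_two (isStrictlyPositive_rpow hG _) h hq' one_le_two le_rfl
    have hne : q + s / 2 - 1 ≠ 0 := by linarith
    have hne' : q + s - 1 ≠ 0 := by linarith
    have hs0 : s ≠ 0 := by linarith
    have e1 : s / 2 / (q + s / 2 - 1) * ((q + s / 2 - 1) / (s / 2)) = 1 := by
      rw [div_mul_div_comm, mul_comm, div_self (mul_ne_zero hne (by positivity))]
    have e2 : 2 / ((q + s / 2 - 1) / (s / 2) + 2 - 1) = s / (q + s - 1) := by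
      have : (q + s / 2 - 1) / (s / 2) + 2 - 1 = (q + s - 1) / (s / 2) := by field_simp; ring
      rw [this]
      field_simp
    rw [rpow_rpow_of_isStrictlyPositive hG, e1, CFC.rpow_one _ hG.nonneg, e2,
      rpow_rpow_of_isStrictlyPositive ha, rpow_rpow_of_isStrictlyPositive ha,
      rpow_conj_rpow_conj ha, show s / 2 * ((2 - 1) / 2) + (s / 2 - 1) / 2 = (s - 1) / 2 by ring,
      show s / 2 * 2 = s by ring] at h'
    exact h'

/-- Furuta's inequality with `s = 1 + r`, followed by Löwner–Heinz with exponent `r/(1 + r)`. -/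
lemma rpow_conj_rpow_le {a b : 𝒜} (hb : IsStrictlyPositive b) (hba : b ≤ a)
    {q r : ℝ} (hq : 1 ≤ q) (hr : 0 ≤ r) :
    (a ^ (r / 2) * b ^ q * a ^ (r / 2)) ^ (r / (q + r)) ≤ a ^ r := by
  have ha := hb.of_le hba
  have h := CFC.rpow_le_rpow (p := r / (1 + r))
    ⟨div_nonneg hr (by linarith), (div_le_one (by linarith)).2 (by linarith)⟩
    (furuta hb hba hq (s := 1 + r) (by linarith))
  have hne : q + r ≠ 0 := by linarith
  have hne' : 1 + r ≠ 0 := by linarith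
  rw [rpow_rpow_of_isStrictlyPositive (isStrictlyPositive_rpow_conj ha
      (isStrictlyPositive_rpow hb q) _), rpow_rpow_of_isStrictlyPositive ha,
    add_sub_cancel_left, show q + (1 + r) - 1 = q + r by ring,
    show (1 + r) / (q + r) * (r / (1 + r)) = r / (q + r) by field_simp,
    show (1 + r) * (r / (1 + r)) = r by field_simp] at h
  exact h

/-! ### Bounded powers, inverses and roots. -/

/-- Undoing the root and the congruence bounds `‖x^N‖` uniformly in `N`, which is impossible if `‖x‖
> 1`. -/
lemma le_one_of_conj_pow_rpow_le {x w k : 𝒜} (hx : IsStrictlyPositive x) (hw : IsUnit w)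
    {m : ℕ} (hm : m ≠ 0)
    (h : ∀ N : ℕ, 1 ≤ N → (w * x ^ (N : ℝ) * star w) ^ (1 / (m : ℝ)) ≤ k) : x ≤ 1 := by
  rw [← CStarAlgebra.norm_le_one_iff_of_nonneg x hx.nonneg]
  by_contra! hlt
  obtain ⟨v, hv⟩ := hw
  set c := ‖(↑v⁻¹ : 𝒜)‖ * ‖k‖ ^ m * ‖star (↑v⁻¹ : 𝒜)‖
  have hbd : ∀ N : ℕ, 1 ≤ N → ‖x ^ N‖ ≤ c := by
    intro N hN
    have hG : IsStrictlyPositive (w * x ^ (N : ℝ) * star w) :=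
      (IsUnit.isStrictlyPositive_star_right_conjugate_iff ⟨v, hv⟩).2 (isStrictlyPositive_rpow hx _)
    have h1 := CStarAlgebra.norm_le_norm_of_nonneg_of_le CFC.rpow_nonneg (h N hN)
    have h2 : w * x ^ N * star w = ((w * x ^ (N : ℝ) * star w) ^ (1 / (m : ℝ))) ^ m := by
      rw [← CFC.rpow_natCast _ m CFC.rpow_nonneg, rpow_rpow_of_isStrictlyPositive hG,
        one_div_mul_cancel (by exact_mod_cast hm), CFC.rpow_one _ hG.nonneg,
        CFC.rpow_natCast x N hx.nonneg]
    have h3 : ‖w * x ^ N * star w‖ ≤ ‖k‖ ^ m := by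
      rw [h2]
      exact (norm_pow_le' _ (Nat.pos_of_ne_zero hm)).trans (pow_le_pow_left₀ (norm_nonneg _) h1 m)
    have h4 : x ^ N = (↑v⁻¹ : 𝒜) * (w * x ^ N * star w) * star (↑v⁻¹ : 𝒜) := by
      have : star w * star (↑v⁻¹ : 𝒜) = 1 := by rw [← star_mul, ← hv, Units.inv_mul, star_one]
      rw [mul_assoc, mul_assoc, mul_assoc, this, mul_one, ← mul_assoc, ← hv, Units.inv_mul, one_mul]
    rw [h4]
    exact (norm_mul_le _ _).trans (mul_le_mul_of_nonneg_right ((norm_mul_le _ _).trans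
      (mul_le_mul_of_nonneg_left h3 (norm_nonneg _))) (norm_nonneg _))
  obtain ⟨j, hj⟩ := pow_unbounded_of_one_lt c hlt
  -- For self-adjoint `x` the C*-identity gives `‖x^{2^j}‖ = ‖x‖^{2^j}`.
  have h5 := hbd (2 ^ j) Nat.one_le_two_pow
  rw [hx.isSelfAdjoint.norm_pow_two_pow] at h5
  exact absurd (hj.trans_le ((pow_le_pow_right₀ hlt.le Nat.lt_two_pow_self.le).trans h5))
    (lt_irrefl _)

lemma rpow_neg_one_rpow {a : 𝒜} (ha : IsStrictlyPositive a) (x : ℝ) :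
    (a ^ (-1 : ℝ)) ^ x = a ^ (-x) := by
  rw [rpow_rpow_of_isStrictlyPositive ha, neg_one_mul]

lemma rpow_neg_one_le_rpow_neg_one_iff {a b : 𝒜} (ha : IsStrictlyPositive a)
    (hb : IsStrictlyPositive b) : a ^ (-1 : ℝ) ≤ b ^ (-1 : ℝ) ↔ b ≤ a := by
  refine ⟨fun h => ?_, fun h => CStarAlgebra.rpow_neg_one_le_rpow_neg_one h hb⟩
  have := CStarAlgebra.rpow_neg_one_le_rpow_neg_one h (isStrictlyPositive_rpow ha _)
  rwa [rpow_neg_one_rpow ha, rpow_neg_one_rpow hb, neg_neg, CFC.rpow_one a ha.nonneg,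
    CFC.rpow_one b hb.nonneg] at this

lemma rpow_neg_conj_le_one_iff {a b : 𝒜} (ha : IsStrictlyPositive a) (x : ℝ) :
    a ^ (-x) * b * a ^ (-x) ≤ 1 ↔ b ≤ a ^ (x + x) := by
  have key (c : 𝒜) : a ^ x * (a ^ (-x) * c * a ^ (-x)) * a ^ x = c :=
    rpow_conj_rpow_conj_cancel ha (by ring) c
  constructor <;> intro h
  · have := rpow_conj_le_rpow_conj h a x
    rwa [key, mul_one, rpow_mul_rpow ha] at this
  · have := rpow_conj_le_rpow_conj h a (-x)
    rwa [rpow_conj_rpow ha, show -x + (x + x) + -x = 0 by ring, CFC.rpow_zero a ha.nonneg] at this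

lemma one_le_rpow_neg_conj_iff {a b : 𝒜} (ha : IsStrictlyPositive a) (x : ℝ) :
    1 ≤ a ^ (-x) * b * a ^ (-x) ↔ a ^ (x + x) ≤ b := by
  have key (c : 𝒜) : a ^ x * (a ^ (-x) * c * a ^ (-x)) * a ^ x = c :=
    rpow_conj_rpow_conj_cancel ha (by ring) c
  constructor <;> intro h
  · have := rpow_conj_le_rpow_conj h a x
    rwa [key, mul_one, rpow_mul_rpow ha] at this
  · have := rpow_conj_le_rpow_conj h a (-x)
    rwa [rpow_conj_rpow ha, show -x + (x + x) + -x = 0 by ring, CFC.rpow_zero a ha.nonneg] at this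

lemma rpow_one_div_eq_iff {g d : 𝒜} (hg : 0 ≤ g) (hd : 0 ≤ d) {m : ℕ} (hm : m ≠ 0) :
    d ^ m = g ↔ d = g ^ (1 / (m : ℝ)) := by
  have hm' : (m : ℝ) ≠ 0 := by exact_mod_cast hm
  have hm0 : (0 : ℝ) ≤ m := m.cast_nonneg
  constructor
  · rintro rfl
    rw [← CFC.rpow_natCast d m hd, CFC.rpow_rpow_of_exponent_nonneg d _ _ hm0 (by positivity) hd,
      mul_one_div_cancel hm', CFC.rpow_one d hd]
  · rintro rfl
    rw [← CFC.rpow_natCast _ m CFC.rpow_nonneg,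
      CFC.rpow_rpow_of_exponent_nonneg g _ _ (by positivity) hm0 hg,
      one_div_mul_cancel hm', CFC.rpow_one g hg]

end CStar

/-! ### The nested expression along monotone sequences. -/

variable {H : Type*} [NormedAddCommGroup H] [InnerProductSpace ℂ H] [CompleteSpace H]

lemma one_le_psi {t p : ℕ → ℝ} {n : ℕ} (ht : ∀ i, 1 ≤ i → i ≤ n → t i ∈ Set.Icc (0 : ℝ) 1)
    (hp : ∀ j, 1 ≤ j → j ≤ 2 * n → 1 ≤ p j) : 1 ≤ psi t p n := by
  induction n with
  | zero => exact le_rfl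
  | succ k ih =>
    have h := ih (fun i h1 h2 => ht i h1 (by omega)) (fun j h1 h2 => hp j h1 (by omega))
    have h1 := hp (2 * k + 1) (by omega) (by omega)
    have h2 := hp (2 * k + 2) (by omega) (by omega)
    obtain ⟨h3, h4⟩ := ht (k + 1) (by omega) le_rfl
    have h5 : 1 ≤ psi t p k * p (2 * k + 1) := one_le_mul_of_one_le_of_one_le h h1
    rw [psi]
    nlinarith

lemma isStrictlyPositive_nest {B : ℕ → H →L[ℂ] H} (hB : ∀ j, 1 ≤ j → IsStrictlyPositive (B j))
    (t p : ℕ → ℝ) : ∀ k, IsStrictlyPositive (nest B t p k)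
  | 0 => isStrictlyPositive_one
  | 1 => isStrictlyPositive_rpow (isStrictlyPositive_rpow_conj (hB 2 (by omega))
      (isStrictlyPositive_rpow (hB 1 le_rfl) _) _) _
  | k + 2 => isStrictlyPositive_rpow (isStrictlyPositive_rpow_conj (hB _ (by omega))
      (isStrictlyPositive_rpow (isStrictlyPositive_rpow_conj (hB _ (by omega))
        (isStrictlyPositive_nest hB t p (k + 1)) _) _) _) _

lemma rpow_neg_one_comm {a : H →L[ℂ] H} (ha : IsStrictlyPositive a) (x : ℝ) :
    (a ^ (-1 : ℝ)) ^ x = (a ^ x) ^ (-1 : ℝ) := by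
  rw [rpow_neg_one_rpow ha, rpow_rpow_of_isStrictlyPositive ha, mul_neg_one]

lemma rpow_neg_one_conj {a b : H →L[ℂ] H} (ha : IsStrictlyPositive a) (hb : IsStrictlyPositive b)
    (x : ℝ) : (a ^ (-1 : ℝ)) ^ x * b ^ (-1 : ℝ) * (a ^ (-1 : ℝ)) ^ x =
      (a ^ x * b * a ^ x) ^ (-1 : ℝ) := by
  rw [rpow_conj_neg_one ha hb, rpow_neg_one_rpow ha]

/-- Inversion commutes with powers and turns congruence by `a^x` into congruence by `(a⁻¹)^x`; this
transfers results from increasing to decreasing sequences. -/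
lemma nest_rpow_neg_one {B : ℕ → H →L[ℂ] H} (hB : ∀ j, 1 ≤ j → IsStrictlyPositive (B j))
    (t p : ℕ → ℝ) : ∀ k, nest (fun j => B j ^ (-1 : ℝ)) t p k = nest B t p k ^ (-1 : ℝ)
  | 0 => by simp [nest]
  | 1 => by
    have h1 := hB 1 le_rfl
    have h2 := hB 2 (by omega)
    have hX := isStrictlyPositive_rpow_conj h2 (isStrictlyPositive_rpow h1 (p 1)) (-(t 1 / 2))
    simp only [nest]
    rw [rpow_neg_one_comm h1, rpow_neg_one_conj h2 (isStrictlyPositive_rpow h1 _),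
      rpow_neg_one_comm hX]
  | k + 2 => by
    have h3 := hB (2 * k + 3) (by omega)
    have h4 := hB (2 * k + 4) (by omega)
    have hN := isStrictlyPositive_nest hB t p (k + 1)
    have hX := isStrictlyPositive_rpow_conj h3 hN (t (k + 1) / 2)
    have hX' := isStrictlyPositive_rpow hX (p (2 * k + 3))
    simp only [nest]
    rw [nest_rpow_neg_one hB t p (k + 1), rpow_neg_one_conj h3 hN, rpow_neg_one_comm hX,
      rpow_neg_one_conj h4 hX', rpow_neg_one_comm (isStrictlyPositive_rpow_conj h4 hX' _)]

lemma exists_nest_eq {B : ℕ → H →L[ℂ] H} (hB : ∀ j, 1 ≤ j → IsStrictlyPositive (B j))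
    (hmono : ∀ j, 1 ≤ j → B j ≤ B (j + 1)) {t p : ℕ → ℝ} (k : ℕ)
    (ht : ∀ i, 1 ≤ i → i ≤ k + 1 → t i ∈ Set.Icc (0 : ℝ) 1)
    (hp : ∀ j, 1 ≤ j → j ≤ 2 * (k + 1) → 1 ≤ p j) :
    ∃ e : H →L[ℂ] H, IsStrictlyPositive e ∧ e ≤ B (2 * (k + 1)) ∧
      nest B t p (k + 1) = B (2 * (k + 1)) ^ (-(t (k + 1) / 2)) * e ^ psi t p (k + 1) *
        B (2 * (k + 1)) ^ (-(t (k + 1) / 2)) := by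
  induction k with
  | zero =>
    obtain ⟨e, he, hle, heq⟩ := exists_rpow_conj_eq (hB 1 le_rfl) (hmono 1 le_rfl)
      (ht 1 le_rfl le_rfl) (hp 1 le_rfl (by omega)) (hp 2 (by omega) le_rfl)
    refine ⟨e, he, hle, ?_⟩
    simpa [nest, psi] using heq
  | succ k ih =>
    have ht' : ∀ i, 1 ≤ i → i ≤ k + 1 → t i ∈ Set.Icc (0 : ℝ) 1 :=
      fun i h1 h2 => ht i h1 (by omega)
    have hp' : ∀ j, 1 ≤ j → j ≤ 2 * (k + 1) → 1 ≤ p j := fun j h1 h2 => hp j h1 (by omega)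
    obtain ⟨e, he, hle, heq⟩ := ih ht' hp'
    have hψ := one_le_psi ht' hp'
    have hp3 := hp (2 * k + 3) (by omega) (by omega)
    have hX := isStrictlyPositive_rpow_conj (hB (2 * k + 3) (by omega))
      (isStrictlyPositive_nest hB t p (k + 1)) (t (k + 1) / 2)
    -- The odd-indexed layer: the `ψ[2(k+1)]`-th root of the inner congruence stays below `B (2 * k
    -- + 3)`. It serves as the new base, with exponent `ψ[2(k+1)] p_{2k+3}`, so the even-indexed
    -- layer reproduces the recursion of `psi`.
    have hle' := conj_conj_rpow_inv_le he hle (hmono (2 * (k + 1)) (by omega))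
      (ht (k + 1) (by omega) (by omega)) hψ
    rw [← heq] at hle'
    obtain ⟨f, hf, hfle, hfeq⟩ := exists_rpow_conj_eq (isStrictlyPositive_rpow hX _)
      (hle'.trans (hmono (2 * k + 3) (by omega))) (ht (k + 2) (by omega) le_rfl)
      (one_le_mul_of_one_le_of_one_le hψ hp3) (hp (2 * k + 4) (by omega) (by omega))
    refine ⟨f, hf, hfle, ?_⟩
    rw [rpow_rpow_of_isStrictlyPositive hX, inv_mul_cancel_left₀ (by linarith)] at hfeq
    exact hfeq

lemma conj_nest_rpow_le {B : ℕ → H →L[ℂ] H} (hB : ∀ j, 1 ≤ j → IsStrictlyPositive (B j))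
    (hmono : ∀ j, 1 ≤ j → B j ≤ B (j + 1)) {n m : ℕ} (hn : 1 ≤ n) {t p : ℕ → ℝ} {r : ℝ}
    (h : Admissible n m t p r) :
    (B (2 * n) ^ (r / 2) * nest B t p n * B (2 * n) ^ (r / 2)) ^ (1 / (m : ℝ)) ≤
      B (2 * n) ^ (r - t n) := by
  obtain ⟨k, rfl⟩ : ∃ k, n = k + 1 := ⟨n - 1, by omega⟩
  obtain ⟨e, he, hle, heq⟩ := exists_nest_eq hB hmono k h.t_mem h.one_le_p
  have hψ := one_le_psi h.t_mem h.one_le_p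
  have hr := h.t_le_r
  have key := rpow_conj_rpow_le he hle hψ (sub_nonneg.2 hr)
  have hne : psi t p (k + 1) + (r - t (k + 1)) ≠ 0 := by linarith
  -- For `m = 0` admissibility would force `ψ - t_n + r = 0`, although `ψ ≥ 1` and `r ≥ t_n`.
  have hm : (m : ℝ) ≠ 0 := by
    intro h0
    have := h.r_eq
    rw [h0] at this
    linarith
  have hexp : (r - t (k + 1)) / (psi t p (k + 1) + (r - t (k + 1))) = 1 / (m : ℝ) := by
    rw [div_eq_div_iff hne hm, h.r_eq]
    ring
  rw [hexp] at key
  rwa [heq, rpow_conj_rpow_conj (hB _ (by omega)),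
    show r / 2 + -(t (k + 1) / 2) = (r - t (k + 1)) / 2 by ring]

lemma le_conj_nest_rpow {B : ℕ → H →L[ℂ] H} (hB : ∀ j, 1 ≤ j → IsStrictlyPositive (B j))
    (hanti : ∀ j, 1 ≤ j → B (j + 1) ≤ B j) {n m : ℕ} (hn : 1 ≤ n) {t p : ℕ → ℝ} {r : ℝ}
    (h : Admissible n m t p r) :
    B (2 * n) ^ (r - t n) ≤
      (B (2 * n) ^ (r / 2) * nest B t p n * B (2 * n) ^ (r / 2)) ^ (1 / (m : ℝ)) := by
  have h1 := conj_nest_rpow_le (B := fun j => B j ^ (-1 : ℝ))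
    (fun j hj => isStrictlyPositive_rpow (hB j hj) _)
    (fun j hj => CStarAlgebra.rpow_neg_one_le_rpow_neg_one (hanti j hj) (hB _ (by omega))) hn h
  have hC := hB (2 * n) (by omega)
  have hN := isStrictlyPositive_nest hB t p n
  have hG := isStrictlyPositive_rpow_conj hC hN (r / 2)
  rwa [nest_rpow_neg_one hB, rpow_neg_one_conj hC hN, rpow_neg_one_comm hG, rpow_neg_one_comm hC,
    rpow_neg_one_le_rpow_neg_one_iff (isStrictlyPositive_rpow hG _) (isStrictlyPositive_rpow hC _)]
    at h1

/-! ### Solving the factorization equality. -/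

/-- The strictly positive solutions of the factorization equality are given by an explicit
formula. -/
lemma factorEq_iff {C T Y : H →L[ℂ] H} (hC : IsStrictlyPositive C) (hT : IsStrictlyPositive T)
    (hY : IsStrictlyPositive Y) {m : ℕ} (hm : m ≠ 0) (u r : ℝ) :
    FactorEq m C u r T Y ↔
      T = C ^ (-((r - u) / 2)) * (C ^ (r / 2) * Y * C ^ (r / 2)) ^ (1 / (m : ℝ)) *
        C ^ (-((r - u) / 2)) := by
  obtain ⟨k, rfl⟩ : ∃ k, m = k + 1 := ⟨m - 1, by omega⟩
  have hD : C ^ (r - u) = C ^ ((r - u) / 2) * C ^ ((r - u) / 2) := by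
    rw [rpow_mul_rpow hC, add_halves]
  have hG := isStrictlyPositive_rpow_conj hC hY (r / 2)
  have hdTd := isStrictlyPositive_rpow_conj hC hT ((r - u) / 2)
  -- The first of the two equalities always holds, by `T (D T)^k = (T D)^k T`.
  have hfirst : C ^ (-(u / 2)) * T * (C ^ (r - u) * T) ^ k * C ^ (-(u / 2)) =
      C ^ (-(u / 2)) * (T * C ^ (r - u)) ^ k * T * C ^ (-(u / 2)) := by
    rw [mul_assoc _ _ T, mul_pow_mul, mul_assoc (C ^ (-(u / 2))) T]
  have hpow : C ^ (r / 2) * (C ^ (-(u / 2)) * (T * C ^ (r - u)) ^ k * T * C ^ (-(u / 2))) *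
      C ^ (r / 2) = (C ^ ((r - u) / 2) * T * C ^ ((r - u) / 2)) ^ (k + 1) := by
    rw [mul_assoc (C ^ (-(u / 2))), rpow_conj_rpow_conj hC,
      show r / 2 + -(u / 2) = (r - u) / 2 by ring, hD, pow_succ, ← mul_assoc T,
      ← mul_assoc (C ^ ((r - u) / 2)) ((T * C ^ ((r - u) / 2) * C ^ ((r - u) / 2)) ^ k),
      ← mul_pow_mul, ← mul_assoc (C ^ ((r - u) / 2)) T]
    simp only [mul_assoc]
  have hinj (Z W : H →L[ℂ] H) :
      C ^ (r / 2) * Z * C ^ (r / 2) = C ^ (r / 2) * W * C ^ (r / 2) ↔ Z = W := by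
    have hu := (isStrictlyPositive_rpow hC (r / 2)).isUnit
    rw [hu.mul_left_inj, hu.mul_right_inj]
  have hsolve (Z : H →L[ℂ] H) : C ^ ((r - u) / 2) * T * C ^ ((r - u) / 2) = Z ↔
      T = C ^ (-((r - u) / 2)) * Z * C ^ (-((r - u) / 2)) := by
    constructor
    · rintro rfl
      rw [rpow_conj_rpow_conj_cancel hC (by ring)]
    · intro h
      rw [h, rpow_conj_rpow_conj_cancel hC (by ring)]
  rw [← hsolve, ← rpow_one_div_eq_iff hG.nonneg hdTd.nonneg hm, ← hpow, hinj, FactorEq,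
    Nat.add_sub_cancel]
  exact and_iff_right hfirst

lemma rpow_conj_le_iff_existsUnique_contraction {C Y : H →L[ℂ] H} (hC : IsStrictlyPositive C)
    (hY : IsStrictlyPositive Y) {m : ℕ} (hm : m ≠ 0) (u r : ℝ) :
    (C ^ (r / 2) * Y * C ^ (r / 2)) ^ (1 / (m : ℝ)) ≤ C ^ (r - u) ↔
      ∃ S : H →L[ℂ] H, IsStrictlyPositive S ∧ FactorEq m C u r S Y ∧ ‖S‖ ≤ 1 ∧
        ∀ S' : H →L[ℂ] H, IsStrictlyPositive S' → FactorEq m C u r S' Y → S' = S := by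
  have hR := isStrictlyPositive_rpow (isStrictlyPositive_rpow_conj hC hY (r / 2)) (1 / (m : ℝ))
  have hS := isStrictlyPositive_rpow_conj hC hR (-((r - u) / 2))
  rw [← add_halves (r - u), ← rpow_neg_conj_le_one_iff hC,
    ← CStarAlgebra.norm_le_one_iff_of_nonneg _ hS.nonneg]
  constructor
  · intro h
    refine ⟨_, hS, (factorEq_iff hC hS hY hm u r).2 rfl, h, fun S' hS' h' => ?_⟩
    exact (factorEq_iff hC hS' hY hm u r).1 h'
  · rintro ⟨S, hSp, hSeq, hSn, -⟩
    rwa [← (factorEq_iff hC hSp hY hm u r).1 hSeq]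

lemma inverse_inverse_of_isStrictlyPositive {S : H →L[ℂ] H} (hS : IsStrictlyPositive S) :
    Ring.inverse (Ring.inverse S) = S := by
  obtain ⟨v, rfl⟩ := hS.isUnit
  simp

lemma norm_inverse_le_one_iff {T : H →L[ℂ] H} (hT : IsStrictlyPositive T) :
    ‖Ring.inverse T‖ ≤ 1 ↔ 1 ≤ T := by
  rw [CStarAlgebra.norm_le_one_iff_of_nonneg _ hT.ringInverse.nonneg,
    CFC.inverse_eq_rpow_neg_one hT]
  simpa using rpow_neg_one_le_rpow_neg_one_iff hT (isStrictlyPositive_one (A := H →L[ℂ] H))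

lemma le_rpow_conj_iff_existsUnique_contraction {C Y : H →L[ℂ] H} (hC : IsStrictlyPositive C)
    (hY : IsStrictlyPositive Y) {m : ℕ} (hm : m ≠ 0) (u r : ℝ) :
    C ^ (r - u) ≤ (C ^ (r / 2) * Y * C ^ (r / 2)) ^ (1 / (m : ℝ)) ↔
      ∃ S : H →L[ℂ] H, IsStrictlyPositive S ∧ FactorEq m C u r (Ring.inverse S) Y ∧ ‖S‖ ≤ 1 ∧
        ∀ S' : H →L[ℂ] H, IsStrictlyPositive S' → FactorEq m C u r (Ring.inverse S') Y →
          S' = S := by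
  have hR := isStrictlyPositive_rpow (isStrictlyPositive_rpow_conj hC hY (r / 2)) (1 / (m : ℝ))
  have hS := isStrictlyPositive_rpow_conj hC hR (-((r - u) / 2))
  rw [← add_halves (r - u), ← one_le_rpow_neg_conj_iff hC, ← norm_inverse_le_one_iff hS]
  constructor
  · intro h
    refine ⟨_, hS.ringInverse, ?_, h, fun S' hS' h' => ?_⟩
    · rw [inverse_inverse_of_isStrictlyPositive hS]
      exact (factorEq_iff hC hS hY hm u r).2 rfl
    · rw [← (factorEq_iff hC hS'.ringInverse hY hm u r).1 h',
        inverse_inverse_of_isStrictlyPositive hS']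
  · rintro ⟨S, hSp, hSeq, hSn, -⟩
    rwa [← (factorEq_iff hC hSp.ringInverse hY hm u r).1 hSeq,
      inverse_inverse_of_isStrictlyPositive hSp]

/-! ### Test parameters that recover the order. -/

/-- The factor `1 · 1 - 1 = 0` cancels the exponent `p₂`, so `N` can grow while `r` stays fixed. -/
lemma psi_one_update (N : ℝ) (n : ℕ) :
    psi (fun _ => 1) (Function.update (fun _ => 1) 2 N) n = 1 := by
  induction n with
  | zero => rfl
  | succ k ih => simp [psi, ih]

/-- With `t_n = ψ = 1` the condition on `r` reads `(r - 1) m = r`. -/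
lemma admissible_one_update {N : ℝ} (hN : 1 ≤ N) (n : ℕ) {m : ℕ} (hm : 2 ≤ m) :
    Admissible n m (fun _ => 1) (Function.update (fun _ => 1) 2 N) (m / (m - 1)) := by
  have h2 : (2 : ℝ) ≤ m := by exact_mod_cast hm
  have h1 : (0 : ℝ) < m - 1 := by linarith
  refine ⟨fun _ _ _ => by simp, fun j _ _ => ?_, ?_, ?_⟩
  · rcases eq_or_ne j 2 with rfl | hj
    · simpa
    · simp [hj]
  · rw [le_div_iff₀ h1]
    linarith
  · rw [psi_one_update]
    field_simp
    ring

/-- With all parameters except `p₂` equal to `1`, the nested expression is a fixed congruence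
of the `p₂`-th power of `B₂^{-1/2} B₁ B₂^{-1/2}`. -/
lemma exists_nest_one_update_eq {B : ℕ → H →L[ℂ] H} (hB : ∀ j, 1 ≤ j → IsStrictlyPositive (B j))
    (k : ℕ) : ∃ w : H →L[ℂ] H, IsUnit w ∧ ∀ N : ℝ,
      nest B (fun _ => 1) (Function.update (fun _ => 1) 2 N) (k + 1) =
        w * (B 2 ^ (-(1 / 2) : ℝ) * B 1 * B 2 ^ (-(1 / 2) : ℝ)) ^ N * star w := by
  induction k with
  | zero =>
    refine ⟨1, isUnit_one, fun N => ?_⟩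
    simp [nest, CFC.rpow_one _ (hB 1 le_rfl).nonneg]
  | succ k ih =>
    obtain ⟨w, hw, h⟩ := ih
    have h3 := hB (2 * k + 3) (by omega)
    have h4 := hB (2 * k + 4) (by omega)
    refine ⟨B (2 * k + 4) ^ (-(1 / 2) : ℝ) * (B (2 * k + 3) ^ (1 / 2 : ℝ) * w),
      (isStrictlyPositive_rpow h4 _).isUnit.mul ((isStrictlyPositive_rpow h3 _).isUnit.mul hw),
      fun N => ?_⟩
    have hX := isStrictlyPositive_rpow_conj h3 (isStrictlyPositive_nest hB (fun _ => 1)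
      (Function.update (fun _ => 1) 2 N) (k + 1)) (1 / 2)
    have hX' := isStrictlyPositive_rpow_conj h4 hX (-(1 / 2))
    rw [nest, Function.update_of_ne (by omega), Function.update_of_ne (by omega),
      CFC.rpow_one _ hX.nonneg, CFC.rpow_one _ hX'.nonneg, h]
    simp only [star_mul, star_rpow, mul_assoc]

lemma le_of_conj_nest_rpow_le {B : ℕ → H →L[ℂ] H} (hB : ∀ j, 1 ≤ j → IsStrictlyPositive (B j))
    {n m : ℕ} (hn : 1 ≤ n) (hm : m ≠ 0) (r : ℝ) {K : H →L[ℂ] H}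
    (h : ∀ N : ℝ, 1 ≤ N →
      (B (2 * n) ^ (r / 2) * nest B (fun _ => 1) (Function.update (fun _ => 1) 2 N) n *
        B (2 * n) ^ (r / 2)) ^ (1 / (m : ℝ)) ≤ K) : B 1 ≤ B 2 := by
  obtain ⟨k, rfl⟩ : ∃ k, n = k + 1 := ⟨n - 1, by omega⟩
  obtain ⟨w, hw, heq⟩ := exists_nest_one_update_eq hB k
  have h1 := hB 1 le_rfl
  have h2 := hB 2 (by omega)
  have key := le_one_of_conj_pow_rpow_le (k := K)
    (isStrictlyPositive_rpow_conj h2 h1 (-(1 / 2)))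
    ((isStrictlyPositive_rpow (hB (2 * (k + 1)) (by omega)) (r / 2)).isUnit.mul hw) hm
    (fun N hN => by
      have := h N (by exact_mod_cast hN)
      rw [heq] at this
      simpa only [star_mul, star_rpow, mul_assoc] using this)
  rwa [rpow_neg_conj_le_one_iff h2, add_halves, CFC.rpow_one _ h2.nonneg] at key

lemma le_of_le_conj_nest_rpow {B : ℕ → H →L[ℂ] H} (hB : ∀ j, 1 ≤ j → IsStrictlyPositive (B j))
    {n m : ℕ} (hn : 1 ≤ n) (hm : m ≠ 0) (r : ℝ) {K : H →L[ℂ] H} (hK : IsStrictlyPositive K)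
    (h : ∀ N : ℝ, 1 ≤ N →
      K ≤ (B (2 * n) ^ (r / 2) * nest B (fun _ => 1) (Function.update (fun _ => 1) 2 N) n *
        B (2 * n) ^ (r / 2)) ^ (1 / (m : ℝ))) : B 2 ≤ B 1 := by
  have h1 := hB 1 le_rfl
  have h2 := hB 2 (by omega)
  have hC := hB (2 * n) (by omega)
  rw [← rpow_neg_one_le_rpow_neg_one_iff h1 h2]
  refine le_of_conj_nest_rpow_le (B := fun j => B j ^ (-1 : ℝ)) (K := K ^ (-1 : ℝ))
    (fun j hj => isStrictlyPositive_rpow (hB j hj) _) hn hm r fun N hN => ?_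
  have hY := isStrictlyPositive_nest hB (fun _ => 1) (Function.update (fun _ => 1) 2 N) n
  rw [nest_rpow_neg_one hB, rpow_neg_one_conj hC hY,
    rpow_neg_one_comm (isStrictlyPositive_rpow_conj hC hY _)]
  exact CStarAlgebra.rpow_neg_one_le_rpow_neg_one (h N hN) hK

/-! ### The sequences `up` and `down`, and the assembly. -/

section Sequences

variable {n : ℕ} {A : ℕ → H →L[ℂ] H}

lemma isStrictlyPositive_up (hn : 1 ≤ n) (hA : ∀ i, 1 ≤ i → i ≤ 2 * n → IsStrictlyPositive (A i))
    {i : ℕ} (hi : 1 ≤ i) (j : ℕ) (hj : 1 ≤ j) : IsStrictlyPositive (up n A i j) :=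
  hA _ (by omega) (by omega)

lemma isStrictlyPositive_down (hA : ∀ i, 1 ≤ i → i ≤ 2 * n → IsStrictlyPositive (A i))
    {i : ℕ} (hi : 1 ≤ i) (hin : i ≤ 2 * n - 1) (j : ℕ) (hj : 1 ≤ j) :
    IsStrictlyPositive (down A i j) :=
  hA _ (by omega) (by omega)

lemma up_mono (h : OrderChain n A) {i : ℕ} (hi : 1 ≤ i) (j : ℕ) (hj : 1 ≤ j) :
    up n A i j ≤ up n A i (j + 1) := by
  unfold up
  rcases lt_or_ge (i + j - 1) (2 * n) with hlt | hge
  · rw [min_eq_left hlt.le, min_eq_left (by omega), show i + (j + 1) - 1 = i + j - 1 + 1 by omega]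
    exact h _ (by omega) hlt
  · rw [min_eq_right hge, min_eq_right (by omega)]

lemma down_anti (h : OrderChain n A) {i : ℕ} (hi : 1 ≤ i) (hin : i ≤ 2 * n - 1) (j : ℕ)
    (hj : 1 ≤ j) : down A i (j + 1) ≤ down A i j := by
  unfold down
  rcases lt_or_ge 1 (i + 2 - j) with hlt | hge
  · rw [max_eq_left hlt.le, max_eq_left (by omega),
      show i + 2 - j = i + 2 - (j + 1) + 1 by omega]
    exact h _ (by omega) (by omega)
  · rw [max_eq_right hge, max_eq_right (by omega)]

lemma up_two_mul {i : ℕ} (hi : 1 ≤ i) : up n A i (2 * n) = A (2 * n) := by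
  rw [up, min_eq_right (by omega)]

lemma down_two_mul {i : ℕ} (hi : 1 ≤ i) (hin : i ≤ 2 * n - 1) : down A i (2 * n) = A 1 := by
  rw [down, max_eq_right (by omega)]

lemma inequality_of_orderChain (hn : 1 ≤ n)
    (hA : ∀ i, 1 ≤ i → i ≤ 2 * n → IsStrictlyPositive (A i)) (h : OrderChain n A)
    {m : ℕ} {t p : ℕ → ℝ} {r : ℝ} (hadm : Admissible n m t p r) {i : ℕ} (hi : 1 ≤ i)
    (hin : i ≤ 2 * n - 1) : Inequality n m A t p r i := by
  unfold Inequality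
  split_ifs with hle
  · have := conj_nest_rpow_le (isStrictlyPositive_up hn hA hi) (up_mono h hi) hn hadm
    rwa [up_two_mul hi] at this
  · have := le_conj_nest_rpow (isStrictlyPositive_down hA hi hin) (down_anti h hi hin) hn hadm
    rwa [down_two_mul hi hin] at this

/-- The first two entries are `A_i, A_{i+1}` for `up` and `A_{i+1}, A_i` for `down`, so the `i`-th
inequality gives precisely the link `A_i ≤ A_{i+1}`. -/
lemma orderChain_of_inequality (hn : 1 ≤ n)
    (hA : ∀ i, 1 ≤ i → i ≤ 2 * n → IsStrictlyPositive (A i)) {m : ℕ} (hm : 2 ≤ m)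
    (h : ∀ (t p : ℕ → ℝ) (r : ℝ), Admissible n m t p r →
      ∀ i, 1 ≤ i → i ≤ 2 * n - 1 → Inequality n m A t p r i) : OrderChain n A := by
  intro i hi hin
  have hin' : i ≤ 2 * n - 1 := by omega
  have key (N : ℝ) (hN : 1 ≤ N) := h _ _ _ (admissible_one_update hN n hm) i hi hin'
  unfold Inequality at key
  split_ifs at key with hle
  · rw [← up_two_mul (A := A) hi] at key
    have := le_of_conj_nest_rpow_le (isStrictlyPositive_up hn hA hi) hn (by omega) _ key
    rwa [up, up, min_eq_left (by omega), min_eq_left (by omega), Nat.add_sub_cancel,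
      show i + 2 - 1 = i + 1 by omega] at this
  · rw [← down_two_mul (A := A) hi hin'] at key
    have := le_of_le_conj_nest_rpow (isStrictlyPositive_down hA hi hin') hn (by omega) _
      (isStrictlyPositive_rpow (isStrictlyPositive_down hA hi hin' (2 * n) (by omega)) _) key
    rwa [down, down, max_eq_left (by omega), max_eq_left (by omega), Nat.add_sub_cancel,
      show i + 2 - 1 = i + 1 by omega] at this

lemma inequality_iff_hasUniqueContraction (hn : 1 ≤ n)
    (hA : ∀ i, 1 ≤ i → i ≤ 2 * n → IsStrictlyPositive (A i)) {m : ℕ} (hm : m ≠ 0)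
    (t p : ℕ → ℝ) (r : ℝ) {i : ℕ} (hi : 1 ≤ i) (hin : i ≤ 2 * n - 1) :
    Inequality n m A t p r i ↔ HasUniqueContraction n m A t p r i := by
  unfold Inequality HasUniqueContraction Equality
  split_ifs with hle
  · exact rpow_conj_le_iff_existsUnique_contraction (hA _ (by omega) le_rfl)
      (isStrictlyPositive_nest (isStrictlyPositive_up hn hA hi) t p n) hm _ _
  · exact le_rpow_conj_iff_existsUnique_contraction (hA _ le_rfl (by omega))
      (isStrictlyPositive_nest (isStrictlyPositive_down hA hi hin) t p n) hm _ _

end Sequences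

end OperatorOrder

theorem theorem3p2 {H : Type*} [NormedAddCommGroup H] [InnerProductSpace ℂ H] [CompleteSpace H]
    (n : ℕ) (hn : 1 ≤ n) (A : ℕ → H →L[ℂ] H)
    (hA : ∀ i, 1 ≤ i → i ≤ 2 * n → IsStrictlyPositive (A i))
    (m : ℕ) (hm : 2 ≤ m) :
    [OperatorOrder.OrderChain n A,
      ∀ (t p : ℕ → ℝ) (r : ℝ), OperatorOrder.Admissible n m t p r →
        ∀ i, 1 ≤ i → i ≤ 2 * n - 1 → OperatorOrder.Inequality n m A t p r i,
      ∀ (t p : ℕ → ℝ) (r : ℝ), OperatorOrder.Admissible n m t p r →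
        ∀ i, 1 ≤ i → i ≤ 2 * n - 1 → OperatorOrder.HasUniqueContraction n m A t p r i].TFAE ∧
    ∀ (t p : ℕ → ℝ) (r : ℝ), OperatorOrder.Admissible n m t p r →
      ∀ i, 1 ≤ i → i ≤ 2 * n - 1 →
        (OperatorOrder.Inequality n m A t p r i ↔
          OperatorOrder.HasUniqueContraction n m A t p r i) := by
  have key (t p : ℕ → ℝ) (r : ℝ) (i : ℕ) (hi : 1 ≤ i) (hin : i ≤ 2 * n - 1) :=
    OperatorOrder.inequality_iff_hasUniqueContraction hn hA (m := m) (by omega) t p r hi hin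
  refine ⟨?_, fun t p r _ i hi hin => key t p r i hi hin⟩
  tfae_have 1 → 2 := fun h t p r hadm i hi hin =>
    OperatorOrder.inequality_of_orderChain hn hA h hadm hi hin
  tfae_have 2 → 1 := OperatorOrder.orderChain_of_inequality hn hA hm
  tfae_have 2 → 3 := fun h t p r hadm i hi hin => (key t p r i hi hin).1 (h t p r hadm i hi hin)
  tfae_have 3 → 2 := fun h t p r hadm i hi hin => (key t p r i hi hin).2 (h t p r hadm i hi hin)
  tfae_finish
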